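/- Let $q,x,y,z$ be indeterminates. Write $[n]_q=1+q+\cdots+q^{n-1}$ and $[n]_q!=\prod_{j=1}^n[j]_q$ (so $[0]_q!=1$). For a sequence $(a_n)_{n\ge 0}$ let $T_\infty((a_n)_{n\ge0})$ be the infinite lower-triangular Toeplitz matrix with $(n,k)$-entry $a_{n-k}$ if $k\le n$ and $0$ otherwise ($n,k\ge 0$), and let $T_\infty(y)=T_\infty((y^n)_{n\ge 0})$. Let $D_q=\mathrm{diag}(([n]_q!)_{n\ge0})$, let $\Delta=(\delta_{n+1,k})_{n,k\ge0}$, and set $$\mathsf P'(q,y,z)=D_q\,T_\infty\big((z^n/[n]_q!)_{n\ge 0}\big)\,T_\infty(y)\,D_q^{-1}\,\Delta ,$$ a row-finite matrix with entries in the field $\mathbb R(q,x,y,z)$. Let $\hat{\mathsf F}(q,y,z)=(\hat f_{n,k}(q,y,z))_{n,k\ge0}$ be its output matrix, that is, $\hat f_{n,k}(q,y,z)=(\mathsf P'(q,y,z)^n)_{0,k}$, and let $$\hat{\mathsf F}_n(x;q,y,z)=\sum_{k=0}^n \hat f_{n,k}(q,y,z)\,x^k\qquad(n\ge 0)$$ be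 its row-generating polynomials. Then every $\hat{\mathsf F}_n(x;q,y,z)$ belongs to $\mathbb R[q,x,y,z]$, and the sequence $(\hat{\mathsf F}_n(x;q,y,z))_{n\ge0}$ is coefficientwise Hankel-totally positive jointly in $q,x,y,z$: every minor of the infinite Hankel matrix $(\hat{\mathsf F}_{n+k}(x;q,y,z))_{n,k\ge 0}$ is a polynomial in $q,x,y,z$ with nonnegative coefficients. -/

import Mathlib

namespace QForest

/-! ### Infinite matrices with rows and columns indexed by the natural numbers -/

section InfiniteMatrices

variable {K : Type*} [Field K]

/-- Every row has only finitely many nonzero entries. -/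
def RowFinite (A : Matrix ℕ ℕ K) : Prop :=
  ∀ n, {k | A n k ≠ 0}.Finite

/-- Product of infinite matrices, `(A B)_{n,k} = ∑_j A_{n,j} B_{j,k}`.  The sum has finite support
as soon as `A` is row-finite, and row-finiteness holds for every left factor below. -/
noncomputable def infMul (A B : Matrix ℕ ℕ K) : Matrix ℕ ℕ K :=
  Matrix.of fun n k => ∑ᶠ j, A n j * B j k

/-- Powers of an infinite matrix. -/
noncomputable def infPow (A : Matrix ℕ ℕ K) : ℕ → Matrix ℕ ℕ K
  | 0 => 1
  | n + 1 => infMul (infPow A n) A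

/-- The output matrix `O(P)`: row `n` of `O(P)` is the zeroth row of `P ^ n`. -/
noncomputable def outputMatrix (P : Matrix ℕ ℕ K) : Matrix ℕ ℕ K :=
  Matrix.of fun n k => infPow P n 0 k

/-- The Toeplitz matrix `T_∞(a)`, with entries `a_{n-k}` for `k ≤ n`, and `0` otherwise. -/
def toeplitz (a : ℕ → K) : Matrix ℕ ℕ K :=
  Matrix.of fun n k => if k ≤ n then a (n - k) else 0

/-- The matrix `Δ = (δ_{n+1,k})`, with `1` on the superdiagonal and `0` elsewhere. -/
def shiftMatrix : Matrix ℕ ℕ K :=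
  Matrix.of fun n k => if n + 1 = k then 1 else 0

/-- `[n]_q = 1 + q + ⋯ + q^(n-1)`. -/
def qNumber (q : K) (n : ℕ) : K := ∑ i ∈ Finset.range n, q ^ i

/-- `[n]_q! = [1]_q [2]_q ⋯ [n]_q`. -/
def qFactorial (q : K) (n : ℕ) : K := ∏ j ∈ Finset.Icc 1 n, qNumber q j

/-- `P'(q,y,z) = D_q T_∞((z^n/[n]_q!)_n) T_∞(y) D_q⁻¹ Δ`, where `D_q = diag([n]_q!)` and
`T_∞(y)` is the Toeplitz matrix of powers of `y`. -/
noncomputable def productionMatrix (q y z : K) : Matrix ℕ ℕ K :=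
  infMul
    (infMul
      (infMul
        (infMul
          (Matrix.diagonal fun n => qFactorial q n)
          (toeplitz fun n => z ^ n / qFactorial q n))
        (toeplitz fun n => y ^ n))
      (Matrix.diagonal fun n => (qFactorial q n)⁻¹))
    shiftMatrix

/-- The matrix `F̂(q,y,z) = O(P'(q,y,z))`. -/
noncomputable def forestMatrix (q y z : K) : Matrix ℕ ℕ K :=
  outputMatrix (productionMatrix q y z)

/-- The row-generating polynomial `F̂_n(x;q,y,z) = ∑_{k=0}^n f̂_{n,k}(q,y,z) x^k`. -/
noncomputable def rowGenerating (q x y z : K) (n : ℕ) : K :=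
  ∑ k ∈ Finset.range (n + 1), forestMatrix q y z n k * x ^ k

/-! All the infinite products above are sums of finite support. -/

theorem rowFinite_diagonal (d : ℕ → K) : RowFinite (Matrix.diagonal d) := fun n =>
  (Set.finite_singleton n).subset fun k hk => by
    by_contra h
    exact hk (Matrix.diagonal_apply_ne _ (fun e => h e.symm))

theorem rowFinite_toeplitz (a : ℕ → K) : RowFinite (toeplitz a) := fun n =>
  (Set.finite_Iic n).subset fun k hk => by
    by_contra h
    exact hk (if_neg h)

theorem rowFinite_shiftMatrix : RowFinite (shiftMatrix : Matrix ℕ ℕ K) := fun n =>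
  (Set.finite_singleton (n + 1)).subset fun k hk => by
    by_contra h
    exact hk (if_neg fun e => h e.symm)

theorem RowFinite.infMul {A B : Matrix ℕ ℕ K} (hA : RowFinite A) (hB : RowFinite B) :
    RowFinite (infMul A B) := fun n =>
  ((hA n).biUnion fun j _ => hB j).subset fun k hk => by
    obtain ⟨j, hj⟩ : ∃ j, A n j * B j k ≠ 0 := by
      by_contra! h
      exact hk (by simp [QForest.infMul, h])
    exact Set.mem_biUnion (x := j) (left_ne_zero_of_mul hj) (right_ne_zero_of_mul hj)

theorem rowFinite_productionMatrix (q y z : K) : RowFinite (productionMatrix q y z) :=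
  ((((rowFinite_diagonal _).infMul (rowFinite_toeplitz _)).infMul
    (rowFinite_toeplitz _)).infMul (rowFinite_diagonal _)).infMul rowFinite_shiftMatrix

theorem RowFinite.infPow {A : Matrix ℕ ℕ K} (hA : RowFinite A) (n : ℕ) :
    RowFinite (infPow A n) := by
  induction n with
  | zero => exact rowFinite_diagonal _
  | succ n ih => exact ih.infMul hA

end InfiniteMatrices

/-! ### Coefficientwise total positivity -/

section TotalPositivity

variable {σ : Type*}

/-- `P ⪰ 0`: all coefficients of the polynomial are nonnegative. -/
def CoeffNonneg (P : MvPolynomial σ ℝ) : Prop :=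
  ∀ m, 0 ≤ P.coeff m

/-- All minors of the matrix are polynomials with nonnegative coefficients: the minors are indexed
by increasing choices of finitely many rows and as many columns. -/
def CoeffTotallyPositive (M : Matrix ℕ ℕ (MvPolynomial σ ℝ)) : Prop :=
  ∀ (r : ℕ) (rows cols : Fin r ↪o ℕ), CoeffNonneg (M.submatrix rows cols).det

/-- The Hankel matrix `H_∞(a) = (a_{n+k})_{n,k}`. -/
def hankel {R : Type*} (a : ℕ → R) : Matrix ℕ ℕ R :=
  Matrix.of fun n k => a (n + k)

/-- The Hankel matrix of the sequence is coefficientwise totally positive. -/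
def CoeffHankelTotallyPositive (a : ℕ → MvPolynomial σ ℝ) : Prop :=
  CoeffTotallyPositive (hankel a)

end TotalPositivity

/-! ### The indeterminates -/

/-- The four indeterminates. -/
inductive Var
  | q
  | x
  | y
  | z

/-- The polynomial ring `ℝ[q,x,y,z]`. -/
abbrev Poly : Type := MvPolynomial Var ℝ

/-- The field of rational functions `ℝ(q,x,y,z)`. -/
abbrev RatFunc4 : Type := FractionRing Poly

/-- An indeterminate, as a rational function. -/
noncomputable def ind (v : Var) : RatFunc4 :=
  algebraMap Poly RatFunc4 (MvPolynomial.X v)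

/-- The inverse of `D_q` is genuine: `[n]_q!` is a nonzero rational function. -/
theorem qFactorial_ind_ne_zero (n : ℕ) : qFactorial (ind Var.q) n ≠ 0 := by
  refine Finset.prod_ne_zero_iff.mpr fun j hj => ?_
  have hj1 : 1 ≤ j := (Finset.mem_Icc.mp hj).1
  have h : qNumber (ind Var.q) j =
      algebraMap Poly RatFunc4 (∑ i ∈ Finset.range j, MvPolynomial.X Var.q ^ i) := by
    simp [qNumber, ind]
  rw [h]
  intro h0
  have h1 : (∑ i ∈ Finset.range j, (MvPolynomial.X Var.q : Poly) ^ i) = 0 :=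
    (map_eq_zero_iff _ (IsFractionRing.injective Poly RatFunc4)).mp h0
  have h2 := congrArg (MvPolynomial.eval fun _ => (1 : ℝ)) h1
  simp at h2
  omega

end QForest

/-! Total positivity of the Hankel matrix of `n ↦ (Wⁿ)₀₀` follows from total positivity of `W`
alone: the Hankel matrix factors as `(Wⁿ⁺ᵏ)₀₀ = ∑ⱼ (Wⁿ)₀ⱼ (Wᵏ)ⱼ₀`, both factors are built up from
`W` row by row (resp. column by column), and Cauchy–Binet applies.

The row-generating polynomials are of this form. Let `B` be the `q`-binomial matrix with entries
`[n choose k]_q xⁿ⁻ᵏ`. Like the factor `T = D_q T_∞(f) D_q⁻¹` of `P' = T Δ`, it is a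
`D_q`-conjugate of a Toeplitz matrix, so `B T = T B`, while the `q`-Pascal recurrence reads
`Δ B = B (Δ + x diag(qⁿ))`. Hence `B W = P' B` for `W = T (Δ + x diag(qⁿ))`, and comparing the
`(0, 0)` entries of `B Wⁿ = P'ⁿ B` gives `(Wⁿ)₀₀ = ∑ₖ (P'ⁿ)₀ₖ xᵏ`. Finally `W` is a product of
totally positive matrices: a `q`-binomial matrix, a `D_q`-conjugate of `T_∞(y)`, and a bidiagonal
matrix. -/

namespace QForest

section Determinants

variable {R m ι : Type*} [CommRing R]

theorem det_mul_eq_sum_prod_mul_det [Fintype m] [DecidableEq m] [Fintype ι]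
    (A : Matrix m ι R) (B : Matrix ι m R) :
    (A * B).det = ∑ p : m → ι, (∏ i, A i (p i)) * (B.submatrix p id).det := by
  classical
  have rows_eq : A * B = fun i => ∑ j, A i j • B j := by
    ext i k
    simp [Matrix.mul_apply, Finset.sum_apply]
  rw [rows_eq]
  refine (Matrix.detRowAlternating.toMultilinearMap.map_sum fun i j => A i j • B j).trans ?_
  exact Finset.sum_congr rfl fun p _ => MultilinearMap.map_smul_univ _ _ _

variable {r : ℕ} [LinearOrder ι]

theorem injective_orderEmbedding_comp_perm :
    Function.Injective fun c : (Fin r ↪o ι) × Equiv.Perm (Fin r) => (c.1 ∘ c.2 : Fin r → ι) := by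
  rintro ⟨g, σ⟩ ⟨g', σ'⟩ h
  obtain rfl : g = g' := OrderEmbedding.range_inj.mp <| by
    simpa only [EquivLike.range_comp] using congrArg Set.range h
  exact Prod.ext rfl (Equiv.ext fun i => g.injective (congrFun h i))

theorem exists_orderEmbedding_comp_perm {p : Fin r → ι} (hp : Function.Injective p) :
    ∃ (g : Fin r ↪o ι) (σ : Equiv.Perm (Fin r)), g ∘ σ = p :=
  ⟨.ofStrictMono _ ((Tuple.monotone_sort p).strictMono_of_injective
    (hp.comp (Tuple.sort p).injective)), (Tuple.sort p)⁻¹, by ext i; simp⟩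

/-- The **Cauchy–Binet formula**. -/
theorem det_mul_eq_sum_orderEmbedding [Fintype ι] [Fintype (Fin r ↪o ι)]
    (A : Matrix (Fin r) ι R) (B : Matrix ι (Fin r) R) :
    (A * B).det = ∑ g : Fin r ↪o ι, (A.submatrix id g).det * (B.submatrix g id).det := by
  rw [det_mul_eq_sum_prod_mul_det, ← Fintype.sum_of_injective _ injective_orderEmbedding_comp_perm
    (fun c => (∏ i, A i (c.1 (c.2 i))) * (B.submatrix (c.1 ∘ c.2) id).det) _ ?_ fun _ => rfl,
    Fintype.sum_prod_type]
  · refine Finset.sum_congr rfl fun g _ => ?_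
    have det_rows (σ : Equiv.Perm (Fin r)) : (B.submatrix (g ∘ σ) id).det =
        (Equiv.Perm.sign σ : ℤ) * (B.submatrix g id).det :=
      Matrix.det_permute σ (B.submatrix g id)
    rw [← Matrix.det_transpose (A.submatrix id g), Matrix.det_apply', Finset.sum_mul]
    refine Finset.sum_congr rfl fun σ _ => ?_
    simp only [det_rows, Matrix.transpose_apply, Matrix.submatrix_apply, id]
    ring
  · intro p hp
    have not_injective : ¬ Function.Injective p := fun h =>
      have ⟨g, σ, hgσ⟩ := exists_orderEmbedding_comp_perm h
      hp ⟨(g, σ), hgσ⟩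
    obtain ⟨i, j, hij, hne⟩ := Function.not_injective_iff.mp not_injective
    rw [Matrix.det_zero_of_row_eq hne (by ext k; simp [hij]), mul_zero]

theorem det_eq_mul_det_of_row_eq_zero (A : Matrix (Fin (r + 1)) (Fin (r + 1)) R)
    (h : ∀ j : Fin r, A 0 j.succ = 0) :
    A.det = A 0 0 * (A.submatrix Fin.succ Fin.succ).det := by
  simp [Matrix.det_succ_row_zero, Fin.sum_univ_succ, h, Matrix.submatrix]

theorem det_eq_mul_det_of_col_eq_zero (A : Matrix (Fin (r + 1)) (Fin (r + 1)) R)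
    (h : ∀ i : Fin r, A i.succ 0 = 0) :
    A.det = A 0 0 * (A.submatrix Fin.succ Fin.succ).det := by
  rw [← Matrix.det_transpose, det_eq_mul_det_of_row_eq_zero _ h,
    ← Matrix.det_transpose (A.submatrix _ _)]
  rfl

end Determinants

section Minors

variable {R m n ι : Type*} [CommRing R] [LinearOrder m] [LinearOrder n] [LinearOrder ι]
  {S : Subsemiring R}

/-- Total positivity relative to a subsemiring `S`, whose elements play the role of the nonnegative
ones: all minors belong to `S`. -/
def TotallyPositive (S : Subsemiring R) (A : Matrix m n R) : Prop :=
  ∀ (r : ℕ) (rows : Fin r ↪o m) (cols : Fin r ↪o n), (A.submatrix rows cols).det ∈ S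

namespace TotallyPositive

theorem transpose {A : Matrix m n R} (hA : TotallyPositive S A) : TotallyPositive S A.transpose :=
  fun r rows cols => by
    rw [← Matrix.transpose_submatrix, Matrix.det_transpose]
    exact hA r cols rows

theorem apply_mem {A : Matrix m n R} (hA : TotallyPositive S A) (i : m) (j : n) : A i j ∈ S := by
  simpa using hA 1 (.ofStrictMono (fun _ => i) (Subsingleton.strictMono _))
    (.ofStrictMono (fun _ => j) (Subsingleton.strictMono _))

theorem of_map {T : Type*} [CommRing T] {φ : R →+* T} (hφ : Function.Injective φ)
    {A : Matrix m n R} (hA : TotallyPositive (S.map φ) (A.map φ)) : TotallyPositive S A := by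
  intro r rows cols
  obtain ⟨a, ha, haφ⟩ := hA r rows cols
  rwa [← hφ (haφ.trans (φ.map_det (A.submatrix rows cols)).symm)]

theorem finsum_mul {A : Matrix m ι R} {B : Matrix ι n R} (hA : TotallyPositive S A)
    (hB : TotallyPositive S B) (hAB : ∀ i k, Function.HasFiniteSupport fun j => A i j * B j k) :
    TotallyPositive S (Matrix.of fun i k => ∑ᶠ j, A i j * B j k) := by
  classical
  intro r rows cols
  obtain ⟨s, hs⟩ : ∃ s : Finset ι, ∀ a b,
      Function.support (fun j => A (rows a) j * B j (cols b)) ⊆ s := by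
    have hfin := Set.finite_iUnion fun a => Set.finite_iUnion fun b => hAB (rows a) (cols b)
    refine ⟨hfin.toFinset, fun a b j hj => ?_⟩
    exact hfin.mem_toFinset.mpr (Set.mem_iUnion.mpr ⟨a, Set.mem_iUnion.mpr ⟨b, hj⟩⟩)
  have truncate : (Matrix.of fun i k => ∑ᶠ j, A i j * B j k).submatrix rows cols =
      A.submatrix rows (Subtype.val : s → ι) * B.submatrix (Subtype.val : s → ι) cols := by
    ext a b
    rw [Matrix.submatrix_apply, Matrix.of_apply, finsum_eq_sum_of_support_subset _ (hs a b),
      ← Finset.sum_coe_sort, Matrix.mul_apply]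
    rfl
  have := Fintype.ofFinite (Fin r ↪o s)
  rw [truncate, det_mul_eq_sum_orderEmbedding]
  exact sum_mem fun g _ => mul_mem (hA r rows (g.trans (OrderEmbedding.subtype _)))
    (hB r (g.trans (OrderEmbedding.subtype _)) cols)

theorem of_det_mem_or_leading {A : Matrix m n R} (hS : ∀ i j, A i j ∈ S)
    (h : ∀ (r : ℕ) (rows : Fin (r + 1) ↪o m) (cols : Fin (r + 1) ↪o n),
      (A.submatrix rows cols).det ∈ S ∨ (∀ j : Fin r, A (rows 0) (cols j.succ) = 0) ∨
        ∀ i : Fin r, A (rows i.succ) (cols 0) = 0) :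
    TotallyPositive S A := by
  intro r
  induction r with
  | zero => simp
  | succ r ih =>
    intro rows cols
    have leading_mul_mem : A (rows 0) (cols 0) *
        ((A.submatrix rows cols).submatrix Fin.succ Fin.succ).det ∈ S :=
      mul_mem (hS _ _) (ih ((Fin.succOrderEmb r).trans rows) ((Fin.succOrderEmb r).trans cols))
    rcases h r rows cols with hdet | hrow | hcol
    · exact hdet
    · exact det_eq_mul_det_of_row_eq_zero (A.submatrix rows cols) hrow ▸ leading_mul_mem
    · exact det_eq_mul_det_of_col_eq_zero (A.submatrix rows cols) hcol ▸ leading_mul_mem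

theorem of_multiplicative {A : Matrix m m R} (hS : ∀ i j, A i j ∈ S)
    (hzero : ∀ i j, i < j → A i j = 0)
    (hmul : ∀ i j k, k ≤ j → j ≤ i → A i k = A i j * A j k) : TotallyPositive S A := by
  refine .of_det_mem_or_leading hS fun r rows cols => ?_
  rcases lt_or_ge (rows 0) (cols 0) with hlt | -
  · left
    have row_zero_eq (j) : A (rows 0) (cols j) = 0 :=
      hzero _ _ (hlt.trans_le (cols.monotone (Fin.zero_le j)))
    rw [Matrix.det_eq_zero_of_row_eq_zero 0 row_zero_eq]
    exact zero_mem S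
  by_cases hcol : ∃ j : Fin r, cols j.succ ≤ rows 0
  · left
    obtain ⟨j, hj⟩ := hcol
    have col_zero_eq (i) : A (rows i) (cols 0) =
        A (rows i) (cols j.succ) * A (cols j.succ) (cols 0) :=
      hmul _ _ _ (cols.monotone (Fin.zero_le _)) (hj.trans (rows.monotone (Fin.zero_le i)))
    rw [← Matrix.det_updateCol_add_smul_self _ (Fin.succ_ne_zero j).symm
      (-A (cols j.succ) (cols 0)),
      Matrix.det_eq_zero_of_column_eq_zero 0 fun i => by simp [col_zero_eq i, mul_comm]]
    exact zero_mem S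
  · push Not at hcol
    exact .inr (.inl fun j => hzero _ _ (hcol j))

theorem vecCons_single_bot [OrderBot n] {N : ℕ} {A : Matrix (Fin N) n R}
    (hA : TotallyPositive S A) :
    TotallyPositive S (Matrix.of (Matrix.vecCons (Pi.single ⊥ 1) A)) := by
  refine .of_det_mem_or_leading (fun i j => ?_) fun r rows cols => ?_
  · cases i using Fin.cases with
    | zero =>
      change (Pi.single ⊥ 1 : n → R) j ∈ S
      rw [Pi.single_apply]
      split_ifs
      exacts [one_mem S, zero_mem S]
    | succ i => exact hA.apply_mem i j
  by_cases h : rows 0 = 0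
  · refine .inr (.inl fun j => ?_)
    have hne : cols j.succ ≠ ⊥ := (bot_le.trans_lt (cols.strictMono j.succ_pos)).ne'
    simp [h, hne]
  · left
    have hne (i) : rows i ≠ 0 :=
      ((Fin.pos_of_ne_zero h).trans_le (rows.monotone (Fin.zero_le i))).ne'
    choose pred hpred using fun i => Fin.exists_succ_eq.mpr (hne i)
    have pred_strictMono : StrictMono pred := fun i j hij =>
      Fin.succ_lt_succ_iff.mp (by simpa only [hpred] using rows.strictMono hij)
    have submatrix_eq : (Matrix.of (Matrix.vecCons (Pi.single ⊥ 1) A)).submatrix rows cols =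
        A.submatrix pred cols := by
      ext i j
      rw [Matrix.submatrix_apply, ← hpred]
      rfl
    exact submatrix_eq ▸ hA _ (.ofStrictMono pred pred_strictMono) cols

theorem of_submatrix_fin {A : Matrix ℕ n R}
    (hA : ∀ N, TotallyPositive S (A.submatrix (Fin.val : Fin N → ℕ) id)) : TotallyPositive S A := by
  intro r rows cols
  obtain ⟨N, hN⟩ := (Set.finite_range rows).bddAbove
  exact hA (N + 1) r (.ofStrictMono (fun i => ⟨rows i, Nat.lt_succ_of_le (hN ⟨i, rfl⟩)⟩)
    fun _ _ hij => rows.strictMono hij) cols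

/-- The first `N + 1` rows of `A` are obtained by placing `(1, 0, 0, …)` on top of the product of
the first `N` rows with `P`. -/
theorem of_recurrence [OrderBot n] {A : Matrix ℕ n R} {P : Matrix n n R}
    (hP : TotallyPositive S P) (hzero : A 0 = Pi.single ⊥ 1)
    (hsucc : ∀ i k, A (i + 1) k = ∑ᶠ j, A i j * P j k)
    (hfin : ∀ i k, Function.HasFiniteSupport fun j => A i j * P j k) : TotallyPositive S A := by
  refine .of_submatrix_fin fun N => ?_
  induction N with
  | zero => exact .of_det_mem_or_leading (fun i => i.elim0) fun r rows => (rows 0).elim0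
  | succ N ih =>
    convert (ih.finsum_mul hP fun i k => hfin i k).vecCons_single_bot using 1
    ext i k
    cases i using Fin.cases with
    | zero => exact congrFun hzero k
    | succ i => exact hsucc i k

theorem of_bidiagonal {A : Matrix ℕ ℕ R} (hS : ∀ i j, A i j ∈ S)
    (hzero : ∀ i j, j ≠ i → j ≠ i + 1 → A i j = 0) : TotallyPositive S A := by
  refine .of_det_mem_or_leading hS fun r rows cols => .inr ?_
  rcases le_or_gt (cols 0) (rows 0) with hle | hlt
  · refine .inr fun i => ?_
    have := rows.strictMono i.succ_pos
    exact hzero _ _ (by omega) (by omega)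
  · refine .inl fun j => ?_
    have := cols.strictMono j.succ_pos
    exact hzero _ _ (by omega) (by omega)

end TotallyPositive

end Minors

section RowFiniteMatrices

variable {K : Type*} [Field K]

theorem RowFinite.hasFiniteSupport_mul {A : Matrix ℕ ℕ K} (hA : RowFinite A) (n : ℕ) (v : ℕ → K) :
    Function.HasFiniteSupport fun j => A n j * v j :=
  (hA n).subset fun _ hj => left_ne_zero_of_mul hj

theorem infMul_assoc {A B : Matrix ℕ ℕ K} (hA : RowFinite A) (hB : RowFinite B)
    (C : Matrix ℕ ℕ K) : infMul (infMul A B) C = infMul A (infMul B C) := by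
  ext n k
  have infMul_eq_sum (X : Matrix ℕ ℕ K) (l : ℕ) :
      infMul A X n l = ∑ i ∈ (hA n).toFinset, A n i * X i l :=
    finsum_eq_sum_of_support_subset _ fun i hi => by simpa using left_ne_zero_of_mul hi
  calc infMul (infMul A B) C n k
    _ = ∑ᶠ j, ∑ i ∈ (hA n).toFinset, A n i * (B i j * C j k) :=
      finsum_congr fun j => by simp only [infMul_eq_sum, Finset.sum_mul, mul_assoc]
    _ = ∑ i ∈ (hA n).toFinset, ∑ᶠ j, A n i * (B i j * C j k) :=
      finsum_sum_comm _ _ fun i _ =>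
        (hB.hasFiniteSupport_mul i fun j => C j k).subset fun j hj => right_ne_zero_of_mul hj
    _ = infMul A (infMul B C) n k := by
      simp only [infMul_eq_sum, ← mul_finsum]
      rfl

theorem infMul_diagonal_left (d : ℕ → K) (A : Matrix ℕ ℕ K) (n k : ℕ) :
    infMul (Matrix.diagonal d) A n k = d n * A n k :=
  (finsum_eq_single _ n fun j hj => by rw [Matrix.diagonal_apply_ne _ hj.symm, zero_mul]).trans
    (by rw [Matrix.diagonal_apply_eq])

theorem infMul_diagonal_right (A : Matrix ℕ ℕ K) (d : ℕ → K) (n k : ℕ) :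
    infMul A (Matrix.diagonal d) n k = A n k * d k :=
  (finsum_eq_single _ k fun j hj => by rw [Matrix.diagonal_apply_ne _ hj, mul_zero]).trans
    (by rw [Matrix.diagonal_apply_eq])

variable (K) in
/-- The row-finite matrices indexed by `ℕ`; bundling them makes `infMul` a monoid law, so that
powers, commutation and intertwining relations are those of `Monoid`. -/
@[ext]
structure RowFiniteMatrix where
  toMatrix : Matrix ℕ ℕ K
  rowFinite : RowFinite toMatrix

namespace RowFiniteMatrix

instance : CoeFun (RowFiniteMatrix K) fun _ => ℕ → ℕ → K := ⟨toMatrix⟩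

noncomputable instance : Monoid (RowFiniteMatrix K) where
  mul A B := ⟨infMul A.toMatrix B.toMatrix, A.rowFinite.infMul B.rowFinite⟩
  one := ⟨1, rowFinite_diagonal _⟩
  mul_assoc A B C := RowFiniteMatrix.ext (infMul_assoc A.rowFinite B.rowFinite C.toMatrix)
  one_mul A := RowFiniteMatrix.ext <| Matrix.ext fun n k =>
    (infMul_diagonal_left _ _ n k).trans (one_mul _)
  mul_one A := RowFiniteMatrix.ext <| Matrix.ext fun n k =>
    (infMul_diagonal_right _ _ n k).trans (mul_one _)

theorem one_apply (n k : ℕ) : (1 : RowFiniteMatrix K) n k = if n = k then 1 else 0 :=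
  Matrix.one_apply

theorem mul_apply (A B : RowFiniteMatrix K) (n k : ℕ) : (A * B) n k = ∑ᶠ j, A n j * B j k := rfl

theorem outputMatrix_apply (P : RowFiniteMatrix K) (n k : ℕ) :
    outputMatrix P.toMatrix n k = (P ^ n) 0 k := by
  have toMatrix_pow : (P ^ n).toMatrix = infPow P.toMatrix n := by
    induction n with
    | zero => rfl
    | succ n ih => exact congrArg (infMul · P.toMatrix) ih
  rw [toMatrix_pow]
  rfl

theorem pow_apply_eq_zero {P : RowFiniteMatrix K} (hP : ∀ i k, i + 1 < k → P i k = 0) {n k : ℕ}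
    (hk : n < k) : (P ^ n) 0 k = 0 := by
  induction n generalizing k with
  | zero => rw [pow_zero, one_apply, if_neg hk.ne]
  | succ n ih =>
    rw [pow_succ, mul_apply]
    refine finsum_eq_zero_of_forall_eq_zero fun j => ?_
    rcases lt_or_ge n j with hj | hj
    · rw [ih hj, zero_mul]
    · rw [hP j k (by omega), mul_zero]

section TotallyPositive

variable {S : Subsemiring K}

theorem totallyPositive_mul {A B : RowFiniteMatrix K} (hA : TotallyPositive S A.toMatrix)
    (hB : TotallyPositive S B.toMatrix) : TotallyPositive S (A * B).toMatrix :=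
  hA.finsum_mul hB fun n k => A.rowFinite.hasFiniteSupport_mul n fun j => B j k

theorem totallyPositive_pow_row_zero {P : RowFiniteMatrix K} (hP : TotallyPositive S P.toMatrix) :
    TotallyPositive S (Matrix.of fun n j => (P ^ n) 0 j) := by
  refine .of_recurrence hP ?_ (fun n k => ?_) fun n k =>
    (P ^ n).rowFinite.hasFiniteSupport_mul 0 fun j => P j k
  · ext j
    simp [one_apply, Pi.single_apply, eq_comm]
  · simp only [Matrix.of_apply, pow_succ, mul_apply]

theorem totallyPositive_pow_col_zero {P : RowFiniteMatrix K} (hP : TotallyPositive S P.toMatrix) :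
    TotallyPositive S (Matrix.of fun j n => (P ^ n) j 0) := by
  refine .transpose (A := Matrix.of fun n j => (P ^ n) j 0) <|
    .of_recurrence hP.transpose ?_ (fun n k => ?_) fun n k => ?_
  · ext j
    simp [one_apply, Pi.single_apply]
  · simp only [Matrix.of_apply, Matrix.transpose_apply, pow_succ', mul_apply, mul_comm]
  · exact (P.rowFinite k).subset fun j hj => right_ne_zero_of_mul hj

theorem totallyPositive_hankel_pow {P : RowFiniteMatrix K} (hP : TotallyPositive S P.toMatrix) :
    TotallyPositive S (hankel fun n => (P ^ n) 0 0) := by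
  have hankel_eq : hankel (fun n => (P ^ n) 0 0) =
      Matrix.of fun n k => ∑ᶠ j, (P ^ n) 0 j * (P ^ k) j 0 := by
    ext n k
    exact congrArg (fun A : RowFiniteMatrix K => A 0 0) (pow_add P n k)
  rw [hankel_eq]
  exact (totallyPositive_pow_row_zero hP).finsum_mul (totallyPositive_pow_col_zero hP) fun n k =>
    (P ^ n).rowFinite.hasFiniteSupport_mul 0 fun j => (P ^ k) j 0

end TotallyPositive

/-- The diagonal matrix with diagonal entries `d`. -/
def diagonal (d : ℕ → K) : RowFiniteMatrix K := ⟨Matrix.diagonal d, rowFinite_diagonal d⟩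

/-- The Toeplitz matrix of the coefficients of `f`; indexing by power series turns the product of
Toeplitz matrices into the product of series. -/
noncomputable def toeplitz (f : PowerSeries K) : RowFiniteMatrix K :=
  ⟨QForest.toeplitz fun n => PowerSeries.coeff n f, rowFinite_toeplitz _⟩

variable (K) in
/-- The matrix `Δ`, with `1` on the superdiagonal. -/
def shift : RowFiniteMatrix K := ⟨shiftMatrix, rowFinite_shiftMatrix⟩

/-- The matrix `Δ + diag(d)`. -/
def upperBidiagonal (d : ℕ → K) : RowFiniteMatrix K where
  toMatrix := Matrix.of fun n k => if k = n + 1 then 1 else if k = n then d n else 0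
  rowFinite n := (Set.finite_Iic (n + 1)).subset fun k hk => by
    by_contra h
    rw [Set.mem_Iic] at h
    exact hk ((if_neg (by omega)).trans (if_neg (by omega)))

theorem diagonal_inv_mul_diagonal {d : ℕ → K} (hd : ∀ n, d n ≠ 0) :
    diagonal (fun n => (d n)⁻¹) * diagonal d = 1 := by
  ext n k
  change infMul (Matrix.diagonal _) (Matrix.diagonal d) n k = (1 : Matrix ℕ ℕ K) n k
  rw [infMul_diagonal_left, Matrix.diagonal_apply, Matrix.one_apply]
  split_ifs
  exacts [inv_mul_cancel₀ (hd n), mul_zero _]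

theorem toeplitz_apply (f : PowerSeries K) (n k : ℕ) :
    toeplitz f n k = if k ≤ n then PowerSeries.coeff (n - k) f else 0 := rfl

theorem toMatrix_toeplitz_mk (a : ℕ → K) :
    (toeplitz (PowerSeries.mk a)).toMatrix = QForest.toeplitz a := by
  simp only [toeplitz, PowerSeries.coeff_mk]

theorem toeplitz_mul (f g : PowerSeries K) : toeplitz f * toeplitz g = toeplitz (f * g) := by
  ext n k
  rw [mul_apply, finsum_eq_sum_of_support_subset (s := Finset.Ico k (n + 1)), toeplitz_apply]
  · split_ifs with h
    · rw [Finset.sum_Ico_eq_sum_range, mul_comm f g, PowerSeries.coeff_mul,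
        Finset.Nat.sum_antidiagonal_eq_sum_range_succ_mk, Nat.sub_add_comm h]
      refine Finset.sum_congr rfl fun i hi => ?_
      rw [Finset.mem_range] at hi
      rw [toeplitz_apply, toeplitz_apply, if_pos (by omega), if_pos (by omega), mul_comm,
        Nat.add_sub_cancel_left, Nat.sub_add_eq]
    · rw [Finset.Ico_eq_empty (by omega), Finset.sum_empty]
  · intro j hj
    have hjn : j ≤ n := not_lt.mp fun h => left_ne_zero_of_mul hj (if_neg h.not_ge)
    have hkj : k ≤ j := not_lt.mp fun h => right_ne_zero_of_mul hj (if_neg h.not_ge)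
    exact Finset.mem_coe.mpr (Finset.mem_Ico.mpr ⟨hkj, Nat.lt_succ_of_le hjn⟩)

theorem shift_mul_apply (A : RowFiniteMatrix K) (n k : ℕ) : (shift K * A) n k = A (n + 1) k := by
  rw [mul_apply, finsum_eq_single _ (n + 1) fun j hj => by simp [shift, shiftMatrix, hj.symm]]
  simp [shift, shiftMatrix]

theorem mul_shift_apply_eq_zero {A : RowFiniteMatrix K} (hA : ∀ i j, i < j → A i j = 0) {n k : ℕ}
    (hk : n + 1 < k) : (A * shift K) n k = 0 := by
  refine finsum_eq_zero_of_forall_eq_zero fun j => ?_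
  rcases lt_or_ge n j with hj | hj
  · exact mul_eq_zero_of_left (hA n j hj) _
  · exact mul_eq_zero_of_right _ (if_neg (by omega))

theorem upperBidiagonal_apply (d : ℕ → K) (n k : ℕ) :
    upperBidiagonal d n k = if k = n + 1 then 1 else if k = n then d n else 0 := rfl

theorem mul_upperBidiagonal_apply_zero (A : RowFiniteMatrix K) (d : ℕ → K) (n : ℕ) :
    (A * upperBidiagonal d) n 0 = A n 0 * d 0 := by
  rw [mul_apply, finsum_eq_single _ 0 fun j hj => by simp [upperBidiagonal_apply, hj.symm]]
  simp [upperBidiagonal_apply]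

theorem mul_upperBidiagonal_apply_succ (A : RowFiniteMatrix K) (d : ℕ → K) (n k : ℕ) :
    (A * upperBidiagonal d) n (k + 1) = A n k + A n (k + 1) * d (k + 1) := by
  rw [mul_apply, finsum_eq_sum_of_support_subset (s := {k, k + 1}), Finset.sum_pair (by omega)]
  · simp [upperBidiagonal_apply]
  · intro j hj
    have hentry := right_ne_zero_of_mul hj
    rw [upperBidiagonal_apply] at hentry
    simp only [Finset.coe_pair, Set.mem_insert_iff, Set.mem_singleton_iff]
    grind

theorem totallyPositive_upperBidiagonal {S : Subsemiring K} {d : ℕ → K} (hd : ∀ n, d n ∈ S) :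
    TotallyPositive S (upperBidiagonal d).toMatrix := by
  refine .of_bidiagonal (fun i j => ?_) fun i j hij hij' => ?_
  · rw [upperBidiagonal_apply]
    split_ifs
    exacts [one_mem S, hd i, zero_mem S]
  · rw [upperBidiagonal_apply, if_neg hij', if_neg hij]

/-- The conjugate `D T_∞(f) D⁻¹` of a Toeplitz matrix by `D = diag(d)`. -/
noncomputable def scaledToeplitz (d : ℕ → K) (f : PowerSeries K) : RowFiniteMatrix K :=
  diagonal d * toeplitz f * diagonal fun n => (d n)⁻¹

theorem scaledToeplitz_apply (d : ℕ → K) (f : PowerSeries K) (n k : ℕ) :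
    scaledToeplitz d f n k = if k ≤ n then d n * PowerSeries.coeff (n - k) f * (d k)⁻¹ else 0 := by
  refine (infMul_diagonal_right _ _ n k).trans ?_
  refine (congrArg (· * (d k)⁻¹) (infMul_diagonal_left _ _ n k)).trans ?_
  rw [toeplitz_apply, mul_ite, ite_mul, mul_zero, zero_mul]

theorem scaledToeplitz_mul {d : ℕ → K} (hd : ∀ n, d n ≠ 0) (f g : PowerSeries K) :
    scaledToeplitz d f * scaledToeplitz d g = scaledToeplitz d (f * g) := by
  have cancel (A : RowFiniteMatrix K) : diagonal (fun n => (d n)⁻¹) * (diagonal d * A) = A := by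
    rw [← mul_assoc, diagonal_inv_mul_diagonal hd, one_mul]
  simp only [scaledToeplitz, mul_assoc, cancel, ← toeplitz_mul]

theorem totallyPositive_scaledToeplitz_geometric {S : Subsemiring K} {d : ℕ → K}
    (hd : ∀ n, d n ≠ 0) (hdS : ∀ n, d (n + 1) / d n ∈ S) {y : K} (hy : y ∈ S) :
    TotallyPositive S (scaledToeplitz d (PowerSeries.mk (y ^ ·))).toMatrix := by
  have ratio_mem (k a : ℕ) : d (k + a) / d k ∈ S := by
    induction a with
    | zero => rw [add_zero, div_self (hd k)]; exact one_mem S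
    | succ a ih =>
      rw [← div_mul_div_cancel₀ (hd (k + a))]
      exact mul_mem (hdS _) ih
  refine .of_multiplicative (fun i j => ?_) (fun i j hij => ?_) fun i j k hkj hji => ?_
  · rw [scaledToeplitz_apply]
    split_ifs with hji
    · obtain ⟨a, rfl⟩ := Nat.exists_eq_add_of_le hji
      rw [PowerSeries.coeff_mk, mul_right_comm, ← div_eq_mul_inv]
      exact mul_mem (ratio_mem j a) (pow_mem hy _)
    · exact zero_mem S
  · rw [scaledToeplitz_apply, if_neg hij.not_ge]
  · simp only [scaledToeplitz_apply, PowerSeries.coeff_mk, if_pos hkj, if_pos hji,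
      if_pos (hkj.trans hji), ← Nat.sub_add_sub_cancel hji hkj, pow_add]
    field_simp [hd j]

end RowFiniteMatrix

end RowFiniteMatrices

section QBinomial

open RowFiniteMatrix

variable {K : Type*} [Field K] {q : K}

theorem qFactorial_zero (q : K) : qFactorial q 0 = 1 := by simp [qFactorial]

theorem qFactorial_succ (q : K) (n : ℕ) :
    qFactorial q (n + 1) = qFactorial q n * qNumber q (n + 1) :=
  Finset.prod_Icc_succ_top (by omega) _

theorem qNumber_add (q : K) (k a : ℕ) :
    qNumber q (k + a) = qNumber q k + q ^ k * qNumber q a := by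
  simp [qNumber, Finset.sum_range_add, pow_add, Finset.mul_sum]

theorem qNumber_mem {S : Subsemiring K} (hq : q ∈ S) (n : ℕ) : qNumber q n ∈ S :=
  sum_mem fun i _ => pow_mem hq i

/-- The `q`-exponential series `∑ xⁿ/[n]_q!`. -/
noncomputable def qExp (q x : K) : PowerSeries K := PowerSeries.mk fun n => x ^ n / qFactorial q n

/-- The matrix of the `q`-binomial coefficients, weighted by `x ^ (n - k)`. -/
noncomputable def qBinomial (q x : K) : RowFiniteMatrix K :=
  scaledToeplitz (qFactorial q) (qExp q x)

theorem qBinomial_apply (q x : K) (n k : ℕ) : qBinomial q x n k =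
    if k ≤ n then qFactorial q n * (x ^ (n - k) / qFactorial q (n - k)) * (qFactorial q k)⁻¹
    else 0 := by
  rw [qBinomial, scaledToeplitz_apply, qExp, PowerSeries.coeff_mk]

theorem qBinomial_zero_left (q x : K) : qBinomial q x 0 = Pi.single 0 1 := by
  ext k
  rw [qBinomial_apply, Pi.single_apply]
  by_cases h : k = 0 <;> simp [h, qFactorial_zero]

section NonvanishingFactorials

variable (hq : ∀ n, qFactorial q n ≠ 0)

include hq

theorem qNumber_succ_ne_zero (n : ℕ) : qNumber q (n + 1) ≠ 0 :=
  right_ne_zero_of_mul (qFactorial_succ q n ▸ hq (n + 1))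

theorem qBinomial_zero_right (x : K) (n : ℕ) : qBinomial q x n 0 = x ^ n := by
  rw [qBinomial_apply, if_pos n.zero_le, qFactorial_zero, Nat.sub_zero, inv_one, mul_one,
    mul_div_cancel₀ _ (hq n)]

theorem qBinomial_self (x : K) (n : ℕ) : qBinomial q x n n = 1 := by
  simp [qBinomial_apply, qFactorial_zero, hq]

/-- The `q`-Pascal recurrence; off the diagonal it is `[n+1] = [k+1] + q^(k+1) [n-k]`. -/
theorem qBinomial_succ_succ (x : K) (n k : ℕ) : qBinomial q x (n + 1) (k + 1) =
    qBinomial q x n k + qBinomial q x n (k + 1) * (x * q ^ (k + 1)) := by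
  rcases lt_trichotomy n k with h | rfl | h
  · simp [qBinomial_apply, show ¬ k ≤ n by omega, show ¬ k + 1 ≤ n by omega]
  · rw [qBinomial_self hq, qBinomial_self hq, qBinomial_apply, if_neg (by omega), zero_mul,
      add_zero]
  · obtain ⟨a, rfl⟩ := Nat.exists_eq_add_of_lt h
    have qNumber_split : qNumber q (k + a + 1 + 1) =
        qNumber q (k + 1) + q ^ (k + 1) * qNumber q (a + 1) := by
      rw [← qNumber_add, show k + a + 1 + 1 = k + 1 + (a + 1) by omega]
    rw [qBinomial_apply, qBinomial_apply, qBinomial_apply, if_pos (by omega), if_pos (by omega),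
      if_pos (by omega), show k + a + 1 + 1 - (k + 1) = a + 1 by omega,
      show k + a + 1 - k = a + 1 by omega, show k + a + 1 - (k + 1) = a by omega,
      qFactorial_succ q (k + a + 1), qNumber_split, qFactorial_succ q k, qFactorial_succ q a]
    have := hq k
    have := hq a
    have := qNumber_succ_ne_zero hq k
    have := qNumber_succ_ne_zero hq a
    field_simp
    ring

theorem shift_mul_qBinomial (x : K) : shift K * qBinomial q x =
    qBinomial q x * upperBidiagonal fun n => x * q ^ n := by
  ext n k
  rw [shift_mul_apply]
  cases k with
  | zero =>
    rw [mul_upperBidiagonal_apply_zero, qBinomial_zero_right hq,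
      qBinomial_zero_right hq, pow_zero, mul_one, pow_succ]
  | succ k => rw [mul_upperBidiagonal_apply_succ, qBinomial_succ_succ hq]

variable {S : Subsemiring K}

theorem totallyPositive_qBinomial (hqS : q ∈ S) {x : K} (hx : x ∈ S) :
    TotallyPositive S (qBinomial q x).toMatrix := by
  refine .of_recurrence (totallyPositive_upperBidiagonal fun n =>
    mul_mem hx (pow_mem hqS n)) (qBinomial_zero_left q x) (fun n k => ?_) fun n k =>
    (qBinomial q x).rowFinite.hasFiniteSupport_mul n _
  rw [← RowFiniteMatrix.mul_apply, ← shift_mul_qBinomial hq, shift_mul_apply]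

theorem sum_pow_scaledToeplitz_mul_shift (f : PowerSeries K) (x : K) (n : ℕ) :
    ∑ k ∈ Finset.range (n + 1), ((scaledToeplitz (qFactorial q) f * shift K) ^ n) 0 k * x ^ k =
      ((scaledToeplitz (qFactorial q) f * upperBidiagonal fun k => x * q ^ k) ^ n) 0 0 := by
  set T := scaledToeplitz (qFactorial q) f
  set P := T * shift K
  set W := T * upperBidiagonal fun k => x * q ^ k
  have commute : qBinomial q x * T = T * qBinomial q x := by
    rw [qBinomial, scaledToeplitz_mul hq, scaledToeplitz_mul hq, mul_comm]
  have intertwine : SemiconjBy (qBinomial q x) W P := by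
    rw [SemiconjBy, ← mul_assoc, commute, mul_assoc, mul_assoc, shift_mul_qBinomial hq]
  have pow_eq_zero {k : ℕ} (hk : n < k) : (P ^ n) 0 k = 0 :=
    pow_apply_eq_zero (fun _ _ => mul_shift_apply_eq_zero fun i j hij => by
      rw [scaledToeplitz_apply, if_neg hij.not_ge]) hk
  calc ∑ k ∈ Finset.range (n + 1), (P ^ n) 0 k * x ^ k
    _ = (P ^ n * qBinomial q x) 0 0 := by
      simp only [RowFiniteMatrix.mul_apply, qBinomial_zero_right hq]
      refine (finsum_eq_sum_of_support_subset _ fun k hk => ?_).symm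
      by_contra hlt
      exact left_ne_zero_of_mul hk (pow_eq_zero (by simpa using hlt))
    _ = (qBinomial q x * W ^ n) 0 0 := by rw [(intertwine.pow_right n).eq]
    _ = (W ^ n) 0 0 := by
      rw [RowFiniteMatrix.mul_apply, qBinomial_zero_left,
        finsum_eq_single _ 0 fun j hj => by rw [Pi.single_eq_of_ne hj, zero_mul],
        Pi.single_eq_same, one_mul]

end NonvanishingFactorials

end QBinomial

section RowGenerating

open RowFiniteMatrix

variable {K : Type*} [Field K]

theorem productionMatrix_eq (q y z : K) : productionMatrix q y z =
    (scaledToeplitz (qFactorial q) (qExp q z * PowerSeries.mk (y ^ ·)) * shift K).toMatrix := by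
  rw [scaledToeplitz, ← toeplitz_mul, ← mul_assoc, productionMatrix,
    ← toMatrix_toeplitz_mk, ← toMatrix_toeplitz_mk]
  rfl

theorem rowGenerating_eq {q : K} (hq : ∀ n, qFactorial q n ≠ 0) (x y z : K) (n : ℕ) :
    rowGenerating q x y z n =
      ((scaledToeplitz (qFactorial q) (qExp q z * PowerSeries.mk (y ^ ·)) *
        upperBidiagonal fun k => x * q ^ k) ^ n) 0 0 := by
  rw [rowGenerating, forestMatrix, productionMatrix_eq, ← sum_pow_scaledToeplitz_mul_shift hq]
  simp only [outputMatrix_apply]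

theorem totallyPositive_hankel_rowGenerating {S : Subsemiring K} {q x y z : K}
    (hq : ∀ n, qFactorial q n ≠ 0) (hqS : q ∈ S) (hx : x ∈ S) (hy : y ∈ S) (hz : z ∈ S) :
    TotallyPositive S (hankel (rowGenerating q x y z)) := by
  have ratio_mem (n : ℕ) : qFactorial q (n + 1) / qFactorial q n ∈ S := by
    rw [qFactorial_succ, mul_div_cancel_left₀ _ (hq n)]
    exact qNumber_mem hqS (n + 1)
  rw [funext (rowGenerating_eq hq x y z), ← scaledToeplitz_mul hq]
  exact totallyPositive_hankel_pow <| totallyPositive_mul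
    (totallyPositive_mul (totallyPositive_qBinomial hq hqS hz)
      (totallyPositive_scaledToeplitz_geometric hq ratio_mem hy))
    (totallyPositive_upperBidiagonal fun n => mul_mem hx (pow_mem hqS n))

end RowGenerating

/-- The polynomials with nonnegative coefficients, for which `TotallyPositive` is coefficientwise
total positivity. -/
def coeffNonnegSubsemiring (σ : Type*) : Subsemiring (MvPolynomial σ ℝ) where
  carrier := {P | CoeffNonneg P}
  mul_mem' {P Q} hP hQ m := by
    classical
    rw [MvPolynomial.coeff_mul]
    exact Finset.sum_nonneg fun a _ => mul_nonneg (hP _) (hQ _)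
  one_mem' m := by
    classical
    rw [MvPolynomial.coeff_one]
    split_ifs <;> norm_num
  add_mem' {P Q} hP hQ m := by
    rw [MvPolynomial.coeff_add]
    exact add_nonneg (hP m) (hQ m)
  zero_mem' m := (MvPolynomial.coeff_zero m).ge

theorem X_mem_coeffNonnegSubsemiring {σ : Type*} (i : σ) :
    MvPolynomial.X i ∈ coeffNonnegSubsemiring σ := fun m => by
  classical
  rw [MvPolynomial.coeff_X]
  split_ifs <;> norm_num

end QForest

theorem lemma6p2_general {A K : Type*} [CommRing A] [Field K] [Algebra A K] [FaithfulSMul A K]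
    {S : Subsemiring A} {q x y z : A} (hq : ∀ n, QForest.qFactorial (algebraMap A K q) n ≠ 0)
    (hqS : q ∈ S) (hx : x ∈ S) (hy : y ∈ S) (hz : z ∈ S) :
    ∃ F : ℕ → A,
      (∀ n, algebraMap A K (F n) = QForest.rowGenerating (algebraMap A K q) (algebraMap A K x)
        (algebraMap A K y) (algebraMap A K z) n) ∧
      QForest.TotallyPositive S (QForest.hankel F) := by
  have mem_map {a : A} (ha : a ∈ S) : algebraMap A K a ∈ S.map (algebraMap A K) :=
    ⟨a, ha, rfl⟩
  have hankel_pos := QForest.totallyPositive_hankel_rowGenerating hq (mem_map hqS) (mem_map hx)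
    (mem_map hy) (mem_map hz)
  choose F _ hF using fun n => hankel_pos.apply_mem n 0
  refine ⟨F, hF, .of_map (FaithfulSMul.algebraMap_injective A K) ?_⟩
  rwa [show (QForest.hankel F).map (algebraMap A K) = QForest.hankel _ from
    congrArg QForest.hankel (funext hF)]

/-- With `q, x, y, z` indeterminates, the row-generating polynomials of `F̂(q,y,z) = O(P'(q,y,z))`,
computed in `ℝ(q,x,y,z)`, are polynomials in `ℝ[q,x,y,z]`, and their sequence is coefficientwise
Hankel-totally positive jointly in `q, x, y, z`. -/
theorem lemma6p2 :
    ∃ F : ℕ → QForest.Poly,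
      (∀ n : ℕ, algebraMap QForest.Poly QForest.RatFunc4 (F n) =
        QForest.rowGenerating (QForest.ind QForest.Var.q) (QForest.ind QForest.Var.x)
          (QForest.ind QForest.Var.y) (QForest.ind QForest.Var.z) n) ∧
      QForest.CoeffHankelTotallyPositive F :=
  have X_mem := QForest.X_mem_coeffNonnegSubsemiring (σ := QForest.Var)
  lemma6p2_general QForest.qFactorial_ind_ne_zero (X_mem .q) (X_mem .x) (X_mem .y) (X_mem .z)
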